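/- Theorem (Lower bounds for the entropy and entropy rate). Let $H\in(0,1)$ and let $B^H=\{B^H_t,\ t\ge 0\}$ be a fractional Brownian motion with Hurst index $H$, i.e. a centered Gaussian process with covariance $$\mathsf E\,B^H_tB^H_s=\tfrac12\bigl(t^{2H}+s^{2H}-|t-s|^{2H}\bigr),\qquad s,t\ge 0.$$ Let $G^H_k=B^H_k-B^H_{k-1}$, $k=1,2,\dots$, be the fractional Gaussian noise, and put $$\sigma_H^2=\frac{\Gamma\left(\frac32-H\right)}{\Gamma\left(H+\frac12\right)\Gamma(2-2H)},\qquad \sigma_H=\sqrt{\sigma_H^2}.$$ For an absolutely continuous random vector $\xi$ in $\mathbb R^n$ with density $p$, let $\mathbf H(\xi)=-\int_{\mathbb R^n}p(x)\log p(x)\,dx$ (natural logarithm) denote its differential entropy. Then for every $n\ge 1$ the vector $(G^H_1,\dots,G^H_n)$ is absolutely continuous with a well-defined finite entropy, and $$\mathbf H(G^H_1,\dots,G^H_n)\ \ge\ \frac n2\Bigl(1+\log(2\pi)+\log\sigma_H^2\Bigr).$$ Moreover, the entropy rate $\mathbf H_\infty(G^H)=\lim_{n\to\infty}\frac1n\mathbf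 H(G^H_1,\dots,G^H_n)$ exists as a finite limit and satisfies $$\mathbf H_\infty(G^H)\ \ge\ \frac{1+\log(2\pi)}2+\log\sigma_H .$$ -/

import Mathlib

open MeasureTheory ProbabilityTheory Filter Topology
open scoped NNReal

/-- `B` is a (one-sided) fractional Brownian motion with Hurst index `H` under `P`: a centered
Gaussian process `(B t)`, `t ≥ 0`, with covariance
`E[B t * B s] = (t ^ (2H) + s ^ (2H) - |t - s| ^ (2H)) / 2`. -/
structure IsFractionalBrownianMotion {Ω : Type*} [MeasurableSpace Ω]
    (H : ℝ) (B : ℝ≥0 → Ω → ℝ) (P : Measure Ω) : Prop where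
  isGaussianProcess : IsGaussianProcess B P
  centered : ∀ t, ∫ ω, B t ω ∂P = 0
  covariance : ∀ t s, ∫ ω, B t ω * B s ω ∂P =
    1 / 2 * ((t : ℝ) ^ (2 * H) + (s : ℝ) ^ (2 * H) - |(t : ℝ) - (s : ℝ)| ^ (2 * H))

/-- The unit increments of `B`. Sequences are indexed from `0` here, so the value at `k` is
`G_{k+1} = B_{k+1} - B_k`, the `(k+1)`-st term of the noise `G_1, G_2, …`. -/
def fractionalGaussianNoise {Ω : Type*} (B : ℝ≥0 → Ω → ℝ) (k : ℕ) (ω : Ω) : ℝ :=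
  B ((k : ℝ≥0) + 1) ω - B (k : ℝ≥0) ω

/-- The random vector formed by the first `n` terms of a sequence of random variables. -/
def initialVector {Ω : Type*} (X : ℕ → Ω → ℝ) (n : ℕ) (ω : Ω) : Fin n → ℝ :=
  fun i => X i ω

/-- The density with respect to Lebesgue measure of a random vector, as a real function. -/
noncomputable def realDensity {Ω : Type*} [MeasurableSpace Ω] {n : ℕ}
    (ξ : Ω → Fin n → ℝ) (P : Measure Ω) (x : Fin n → ℝ) : ℝ :=
  (pdf ξ P volume x).toReal

/-- The random vector `ξ` is absolutely continuous and the integral that defines its entropy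
converges absolutely. -/
def HasEntropy {Ω : Type*} [MeasurableSpace Ω] {n : ℕ}
    (ξ : Ω → Fin n → ℝ) (P : Measure Ω) : Prop :=
  HasPDF ξ P volume ∧
    Integrable (fun x => realDensity ξ P x * Real.log (realDensity ξ P x)) volume

/-- The (differential) entropy `-∫ p(x) log p(x) dx` of a random vector with density `p`. -/
noncomputable def entropy {Ω : Type*} [MeasurableSpace Ω] {n : ℕ}
    (ξ : Ω → Fin n → ℝ) (P : Measure Ω) : ℝ :=
  -∫ x, realDensity ξ P x * Real.log (realDensity ξ P x)

/-- `h` is the entropy rate of the sequence `X`: the limit of the entropies of its initial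
vectors divided by their lengths, these entropies being well defined. -/
def IsEntropyRate {Ω : Type*} [MeasurableSpace Ω]
    (X : ℕ → Ω → ℝ) (P : Measure Ω) (h : ℝ) : Prop :=
  (∀ n : ℕ, 1 ≤ n → HasEntropy (initialVector X n) P) ∧
    Tendsto (fun n : ℕ => entropy (initialVector X n) P / n) atTop (𝓝 h)

/-- The constant `σ_H² = Γ(3/2 - H) / (Γ(H + 1/2) Γ(2 - 2H))`. -/
noncomputable def sigmaSq (H : ℝ) : ℝ :=
  Real.Gamma (3 / 2 - H) / (Real.Gamma (H + 1 / 2) * Real.Gamma (2 - 2 * H))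

/-- The constant `σ_H`, the positive square root of `σ_H²`. -/
noncomputable def sigma (H : ℝ) : ℝ :=
  Real.sqrt (sigmaSq H)

section BetaIntegral

theorem integrableOn_and_integral_Ioo_beta {p q : ℝ} (hp : 0 < p) (hq : 0 < q) :
    IntegrableOn (fun t : ℝ => t ^ (p - 1) * (1 - t) ^ (q - 1)) (Set.Ioo 0 1) ∧
      ∫ t in Set.Ioo (0 : ℝ) 1, t ^ (p - 1) * (1 - t) ^ (q - 1) = beta p q := by
  have hc : IntegrableOn (fun x : ℝ => (x : ℂ) ^ ((p : ℂ) - 1) * (1 - (x : ℂ)) ^ ((q : ℂ) - 1))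
      (Set.Ioc 0 1) := by
    have := Complex.betaIntegral_convergent (u := p) (v := q) (by simpa) (by simpa)
    rwa [intervalIntegrable_iff_integrableOn_Ioc_of_le (by simp)] at this
  have hre : Set.EqOn (fun x : ℝ => ((x : ℂ) ^ ((p : ℂ) - 1) * (1 - (x : ℂ)) ^ ((q : ℂ) - 1)).re)
      (fun t : ℝ => t ^ (p - 1) * (1 - t) ^ (q - 1)) (Set.Ioc 0 1) := by
    intro x hx
    have h0 : (0 : ℝ) ≤ x := hx.1.le
    have h1 : (0 : ℝ) ≤ 1 - x := by linarith [hx.2]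
    simp only
    norm_cast
    rw [← Complex.ofReal_cpow h0, ← Complex.ofReal_cpow h1, Complex.re_mul_ofReal,
      Complex.ofReal_re]
  have hI : IntegrableOn (fun t : ℝ => t ^ (p - 1) * (1 - t) ^ (q - 1)) (Set.Ioc 0 1) :=
    IntegrableOn.congr_fun (Integrable.re hc) hre measurableSet_Ioc
  refine ⟨hI.mono_set Set.Ioo_subset_Ioc_self, ?_⟩
  rw [← integral_Ioc_eq_integral_Ioo, ← setIntegral_congr_fun measurableSet_Ioc hre,
    beta_eq_betaIntegralReal p q hp hq, Complex.betaIntegral,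
    intervalIntegral.integral_of_le (by norm_num), ← RCLike.re_to_complex, ← integral_re hc]
  rfl

theorem image_div_one_add_Ioi : (fun x : ℝ => x / (1 + x)) '' Set.Ioi 0 = Set.Ioo 0 1 := by
  ext t
  constructor
  · rintro ⟨x, hx, rfl⟩
    have hx : 0 < x := hx
    refine ⟨by positivity, ?_⟩
    change x / (1 + x) < 1
    rw [div_lt_one (by positivity)]
    linarith
  · rintro ⟨h0, h1⟩
    have h2 : 0 < 1 - t := by linarith
    refine ⟨t / (1 - t), div_pos h0 h2, ?_⟩
    have h3 : 1 - t ≠ 0 := h2.ne'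
    change t / (1 - t) / (1 + t / (1 - t)) = t
    have h4 : 1 + t / (1 - t) = 1 / (1 - t) := by field_simp; ring
    rw [h4]
    field_simp

theorem integrableOn_and_integral_Ioi_beta {p q : ℝ} (hp : 0 < p) (hq : 0 < q) :
    IntegrableOn (fun x : ℝ => x ^ (p - 1) * (1 + x) ^ (-(p + q))) (Set.Ioi 0) ∧
      ∫ x in Set.Ioi (0 : ℝ), x ^ (p - 1) * (1 + x) ^ (-(p + q)) = beta p q := by
  obtain ⟨hi, hv⟩ := integrableOn_and_integral_Ioo_beta hp hq
  have hd : ∀ x ∈ Set.Ioi (0 : ℝ),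
      HasDerivWithinAt (fun x : ℝ => x / (1 + x)) (1 / (1 + x) ^ 2) (Set.Ioi 0) x := by
    intro x hx
    have hx : 0 < x := hx
    have h1 : 1 + x ≠ 0 := by positivity
    have := ((hasDerivAt_id x).div ((hasDerivAt_id x).const_add 1) h1).hasDerivWithinAt
      (s := Set.Ioi 0)
    convert! this using 1
    simp
  have hinj : Set.InjOn (fun x : ℝ => x / (1 + x)) (Set.Ioi 0) := by
    intro x hx y hy hxy
    have hx : 0 < x := hx
    have hy : 0 < y := hy
    simp only at hxy
    rw [div_eq_div_iff (by positivity) (by positivity)] at hxy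
    linarith
  have hcongr : Set.EqOn (fun x : ℝ => |1 / (1 + x) ^ 2| •
      ((x / (1 + x)) ^ (p - 1) * (1 - x / (1 + x)) ^ (q - 1)))
      (fun x : ℝ => x ^ (p - 1) * (1 + x) ^ (-(p + q))) (Set.Ioi 0) := by
    intro x hx
    have hx : 0 < x := hx
    have h1 : 0 < 1 + x := by positivity
    have h2 : 1 - x / (1 + x) = (1 + x)⁻¹ := by field_simp; ring
    simp only [smul_eq_mul]
    rw [h2, abs_of_pos (by positivity), Real.div_rpow hx.le h1.le, Real.inv_rpow h1.le,
      ← Real.rpow_neg h1.le, one_div, ← Real.rpow_natCast, ← Real.rpow_neg h1.le, div_eq_mul_inv,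
      ← Real.rpow_neg h1.le]
    have : -(p + q) = -((2 : ℕ) : ℝ) + (-(p - 1) + -(q - 1)) := by push_cast; ring
    rw [this, Real.rpow_add h1, Real.rpow_add h1]
    ring
  rw [← image_div_one_add_Ioi] at hi hv
  rw [integrableOn_image_iff_integrableOn_abs_deriv_smul measurableSet_Ioi hd hinj] at hi
  rw [integral_image_eq_integral_abs_deriv_smul measurableSet_Ioi hd hinj,
    setIntegral_congr_fun measurableSet_Ioi hcongr] at hv
  exact ⟨hi.congr_fun hcongr measurableSet_Ioi, hv⟩

end BetaIntegral

section KernelIntegral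

theorem abs_rpow_one_add_sub_one_le {s a : ℝ} (hs : 0 ≤ s) (ha : |a| ≤ 1) :
    |(1 + s) ^ a - 1| ≤ s := by
  have key : ∀ b : ℝ, 0 ≤ b → b ≤ 1 → 1 ≤ (1 + s) ^ b ∧ (1 + s) ^ b ≤ 1 + s := by
    intro b h0 h1
    refine ⟨Real.one_le_rpow (by linarith) h0, ?_⟩
    calc (1 + s) ^ b ≤ (1 + s) ^ (1 : ℝ) := Real.rpow_le_rpow_of_exponent_le (by linarith) h1
      _ = 1 + s := Real.rpow_one _
  rcases le_total 0 a with h | h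
  · obtain ⟨h1, h2⟩ := key a h (by rwa [abs_of_nonneg h] at ha)
    rw [abs_le]; constructor <;> linarith
  · obtain ⟨h1, h2⟩ := key (-a) (by linarith) (by rwa [abs_of_nonpos h] at ha)
    have h3 : (1 + s) ^ a = ((1 + s) ^ (-a))⁻¹ := by
      rw [Real.rpow_neg (by linarith), inv_inv]
    have h4 : ((1 + s) ^ (-a))⁻¹ ≤ 1 := inv_le_one_of_one_le₀ h1
    have h5 : (1 + s)⁻¹ ≤ ((1 + s) ^ (-a))⁻¹ := inv_anti₀ (by linarith) h2
    have h6 : 1 - s ≤ (1 + s)⁻¹ := by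
      rw [inv_eq_one_div, le_div_iff₀ (by linarith)]
      nlinarith
    rw [h3, abs_le]; constructor <;> linarith

theorem abs_rpow_one_add_sub_rpow_le {x a : ℝ} (hx : 0 < x) (ha : |a| ≤ 1) :
    |(1 + x) ^ a - x ^ a| ≤ x ^ (a - 1) := by
  have h1 : (1 + x) ^ a = x ^ a * (1 + x⁻¹) ^ a := by
    rw [← Real.mul_rpow hx.le (by positivity)]
    congr 1
    field_simp
    ring
  have h2 : (1 + x) ^ a - x ^ a = x ^ a * ((1 + x⁻¹) ^ a - 1) := by rw [h1]; ring
  rw [h2, abs_mul, abs_of_pos (Real.rpow_pos_of_pos hx a), Real.rpow_sub_one hx.ne', div_eq_mul_inv]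
  exact mul_le_mul_of_nonneg_left (abs_rpow_one_add_sub_one_le (by positivity) ha)
    (Real.rpow_nonneg hx.le a)

/-- The algebraic part of an antiderivative of `(2 a + 1) * ((1 + x) ^ a - x ^ a) ^ 2`. -/
noncomputable def kernelPrimitive (a x : ℝ) : ℝ :=
  (1 + x) ^ (2 * a + 1) + x ^ (2 * a + 1) - 2 * (x ^ (a + 1) * (1 + x) ^ a) -
    x ^ (a + 1) * (1 + x) ^ (a - 1)

theorem hasDerivAt_kernelPrimitive {a x : ℝ} (hx : 0 < x) :
    HasDerivAt (kernelPrimitive a)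
      ((2 * a + 1) * ((1 + x) ^ a - x ^ a) ^ 2 - (1 - a) * (x ^ a * (1 + x) ^ (a - 2))) x := by
  have h1 : 0 < 1 + x := by positivity
  have hx' : ∀ r : ℝ, HasDerivAt (fun y : ℝ => y ^ r) (r * x ^ (r - 1)) x := fun r =>
    Real.hasDerivAt_rpow_const (Or.inl hx.ne')
  have h1' : ∀ r : ℝ, HasDerivAt (fun y : ℝ => (1 + y) ^ r) (r * (1 + x) ^ (r - 1)) x := fun r => by
    simpa using ((hasDerivAt_id x).const_add 1).rpow_const (p := r) (Or.inl h1.ne')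
  have := (((h1' (2 * a + 1)).add (hx' (2 * a + 1))).sub
    (((hx' (a + 1)).mul (h1' a)).const_mul 2)).sub ((hx' (a + 1)).mul (h1' (a - 1)))
  convert! this using 1
  have e1 : (1 + x) ^ (2 * a + 1 - 1) = (1 + x) ^ a * (1 + x) ^ a := by
    rw [← Real.rpow_add h1]; ring_nf
  have e2 : x ^ (2 * a + 1 - 1) = x ^ a * x ^ a := by
    rw [← Real.rpow_add hx]; ring_nf
  have e3 : x ^ (a + 1) = x ^ a * x := Real.rpow_add_one hx.ne' a
  have e4 : (1 + x) ^ (a - 1) = (1 + x) ^ a / (1 + x) := Real.rpow_sub_one h1.ne' a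
  have e5 : (1 + x) ^ (a - 1 - 1) = (1 + x) ^ a / (1 + x) / (1 + x) := by
    rw [Real.rpow_sub_one h1.ne', e4]
  have e6 : (1 + x) ^ (a - 2) = (1 + x) ^ a / (1 + x) / (1 + x) := by
    rw [← e5]; congr 1; ring
  have e7 : x ^ (a + 1 - 1) = x ^ a := by congr 1; ring
  rw [e1, e2, e3, e5, e6, e7, e4]
  field_simp
  ring

theorem tendsto_kernelPrimitive_atTop {a : ℝ} (ha0 : -(1 / 2) < a) (ha1 : a < 1 / 2) :
    Tendsto (kernelPrimitive a) atTop (𝓝 0) := by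
  have habs : |a| ≤ 1 := by rw [abs_le]; constructor <;> linarith
  have hbound : ∀ᶠ x : ℝ in atTop, ‖kernelPrimitive a x‖ ≤ 6 * x ^ (-(1 - 2 * a)) := by
    filter_upwards [eventually_ge_atTop 1] with x hx1
    have hx : 0 < x := by linarith
    have h1 : 0 < 1 + x := by positivity
    have hd := abs_rpow_one_add_sub_rpow_le hx habs
    set A := (1 + x) ^ a with hA
    set b := x ^ a with hb
    have hb0 : 0 < b := Real.rpow_pos_of_pos hx a
    have hA0 : 0 < A := Real.rpow_pos_of_pos h1 a
    have hd' : |A - b| ≤ b / x := by rwa [Real.rpow_sub_one hx.ne'] at hd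
    have hA2 : A ≤ 2 * b := by
      have : b / x ≤ b := div_le_self hb0.le hx1
      linarith [le_abs_self (A - b)]
    have hF : kernelPrimitive a x = x * (A - b) ^ 2 + A * (A - b) + A * b / (1 + x) := by
      unfold kernelPrimitive
      have e1 : (1 + x) ^ (2 * a + 1) = A * A * (1 + x) := by
        rw [Real.rpow_add_one h1.ne', two_mul, Real.rpow_add h1]
      have e2 : x ^ (2 * a + 1) = b * b * x := by
        rw [Real.rpow_add_one hx.ne', two_mul, Real.rpow_add hx]
      have e3 : x ^ (a + 1) = b * x := Real.rpow_add_one hx.ne' a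
      have e4 : (1 + x) ^ (a - 1) = A / (1 + x) := Real.rpow_sub_one h1.ne' a
      rw [e1, e2, e3, e4, ← hA]
      field_simp
      ring
    have hr : x ^ (-(1 - 2 * a)) = b * b / x := by
      have : -(1 - 2 * a) = a + a - 1 := by ring
      rw [this, Real.rpow_sub_one hx.ne', Real.rpow_add hx]
    have t1 : |x * (A - b) ^ 2| ≤ b * b / x := by
      rw [abs_mul, abs_of_pos hx, abs_pow]
      calc x * |A - b| ^ 2 ≤ x * (b / x) ^ 2 := by gcongr
        _ = b * b / x := by field_simp
    have t2 : |A * (A - b)| ≤ 2 * (b * b / x) := by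
      rw [abs_mul, abs_of_pos hA0]
      calc A * |A - b| ≤ (2 * b) * (b / x) := by gcongr
        _ = 2 * (b * b / x) := by ring
    have t3 : |A * b / (1 + x)| ≤ 2 * (b * b / x) := by
      rw [abs_of_pos (by positivity)]
      calc A * b / (1 + x) ≤ (2 * b) * b / x := by gcongr; linarith
        _ = 2 * (b * b / x) := by ring
    rw [hF, hr, Real.norm_eq_abs]
    have hpos : 0 ≤ b * b / x := by positivity
    linarith [abs_add_le (x * (A - b) ^ 2 + A * (A - b)) (A * b / (1 + x)),
      abs_add_le (x * (A - b) ^ 2) (A * (A - b))]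
  refine squeeze_zero_norm' hbound ?_
  simpa using (tendsto_rpow_neg_atTop (y := 1 - 2 * a) (by linarith)).const_mul 6

theorem continuousWithinAt_kernelPrimitive_zero {a : ℝ} (ha0 : -(1 / 2) < a) :
    ContinuousWithinAt (kernelPrimitive a) (Set.Ici 0) 0 := by
  apply ContinuousAt.continuousWithinAt
  have h : ∀ r : ℝ, ContinuousAt (fun y : ℝ => (1 + y) ^ r) 0 := fun r =>
    (continuousAt_const.add continuousAt_id).rpow_const (Or.inl (by simp))
  have h' : ∀ r : ℝ, 0 < r → ContinuousAt (fun y : ℝ => y ^ r) 0 := fun r hr =>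
    Real.continuousAt_rpow_const _ _ (Or.inr hr.le)
  exact (((h _).add (h' _ (by linarith))).sub
    (((h' _ (by linarith)).mul (h _)).const_mul 2)).sub ((h' _ (by linarith)).mul (h _))

theorem integrableOn_and_integral_Ioi_kernel {a : ℝ} (ha0 : -(1 / 2) < a) (ha1 : a < 1 / 2) :
    IntegrableOn (fun x : ℝ => ((1 + x) ^ a - x ^ a) ^ 2) (Set.Ioi 0) ∧
      (2 * a + 1) * ∫ x in Set.Ioi (0 : ℝ), ((1 + x) ^ a - x ^ a) ^ 2 =
        Real.Gamma (a + 1) * Real.Gamma (1 - 2 * a) / Real.Gamma (1 - a) - 1 := by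
  obtain ⟨hi, hv⟩ := integrableOn_and_integral_Ioi_beta (p := a + 1) (q := 1 - 2 * a)
    (by linarith) (by linarith)
  have hw : (fun x : ℝ => x ^ (a + 1 - 1) * (1 + x) ^ (-(a + 1 + (1 - 2 * a)))) =
      fun x : ℝ => x ^ a * (1 + x) ^ (a - 2) := by
    funext x
    congr 2 <;> ring
  rw [hw] at hi hv
  set w : ℝ → ℝ := fun x => x ^ a * (1 + x) ^ (a - 2) with hwdef
  have hInt : ∀ x : ℝ, 0 ≤ x → IntervalIntegrable w volume 0 x := fun x hx => by
    rw [intervalIntegrable_iff_integrableOn_Ioc_of_le hx]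
    exact hi.mono_set Set.Ioc_subset_Ioi_self
  let G : ℝ → ℝ := fun x => kernelPrimitive a x + (1 - a) * ∫ t in (0 : ℝ)..x, w t
  have hG : ∀ x ∈ Set.Ioi (0 : ℝ),
      HasDerivAt G ((2 * a + 1) * ((1 + x) ^ a - x ^ a) ^ 2) x := by
    intro x hx
    have hx : 0 < x := hx
    have hcont : ContinuousAt w x :=
      (Real.continuousAt_rpow_const _ _ (Or.inl hx.ne')).mul
        ((continuousAt_const.add continuousAt_id).rpow_const
          (Or.inl (show (1 : ℝ) + x ≠ 0 by positivity)))
    have hmeas : Measurable w := by fun_prop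
    have h2 := intervalIntegral.integral_hasDerivAt_right (hInt x hx.le)
      hmeas.stronglyMeasurable.stronglyMeasurableAtFilter hcont
    convert! (hasDerivAt_kernelPrimitive (a := a) hx).add (h2.const_mul (1 - a)) using 1
    simp only [hwdef]
    ring
  have hG0 : ContinuousWithinAt G (Set.Ici 0) 0 := by
    refine (continuousWithinAt_kernelPrimitive_zero ha0).add (ContinuousWithinAt.const_mul ?_ _)
    have := intervalIntegral.continuousWithinAt_primitive (μ := volume) (f := w) (a := 0) (b₀ := 0)
      (b₁ := 0) (b₂ := 1) (by simp) (by simpa using hInt 1 zero_le_one)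
    exact (continuousWithinAt_Icc_iff_Ici zero_lt_one).1 this
  have hGt : Tendsto G atTop (𝓝 (0 + (1 - a) * ∫ x in Set.Ioi (0 : ℝ), w x)) :=
    (tendsto_kernelPrimitive_atTop ha0 ha1).add
      ((intervalIntegral_tendsto_integral_Ioi 0 hi tendsto_id).const_mul _)
  have hpos : ∀ x ∈ Set.Ioi (0 : ℝ), 0 ≤ (2 * a + 1) * ((1 + x) ^ a - x ^ a) ^ 2 := fun x _ =>
    mul_nonneg (by linarith) (sq_nonneg _)
  have hI := integrableOn_Ioi_deriv_of_nonneg hG0 hG hpos hGt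
  have hV := integral_Ioi_of_hasDerivAt_of_nonneg hG0 hG hpos hGt
  have hne : 2 * a + 1 ≠ 0 := by linarith
  refine ⟨?_, ?_⟩
  · have := hI.const_mul (2 * a + 1)⁻¹
    refine IntegrableOn.congr_fun this (fun x _ => ?_) measurableSet_Ioi
    exact inv_mul_cancel_left₀ hne _
  · rw [← integral_const_mul, hV, hv]
    have hG00 : G 0 = 1 := by
      simp [G, kernelPrimitive, Real.zero_rpow hne, Real.zero_rpow (show a + 1 ≠ 0 by linarith)]
    rw [hG00, beta]
    have hΓ : Real.Gamma (a + 1 + (1 - 2 * a)) = (1 - a) * Real.Gamma (1 - a) := by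
      rw [← Real.Gamma_add_one (by linarith)]
      congr 1; ring
    have hΓ0 : Real.Gamma (1 - a) ≠ 0 := (Real.Gamma_pos_of_pos (by linarith)).ne'
    have h1a : 1 - a ≠ 0 := by linarith
    rw [hΓ]
    field_simp
    ring

end KernelIntegral

section MovingAverage

/-- The truncated power `s₊ ^ a`. -/
noncomputable def truncPow (a s : ℝ) : ℝ := if 0 < s then s ^ a else 0

theorem truncPow_of_pos {a s : ℝ} (hs : 0 < s) : truncPow a s = s ^ a := if_pos hs

theorem truncPow_of_nonpos {a s : ℝ} (hs : s ≤ 0) : truncPow a s = 0 := if_neg hs.not_gt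

theorem truncPow_mul {a c s : ℝ} (hc : 0 < c) : truncPow a (c * s) = c ^ a * truncPow a s := by
  rcases le_or_gt s 0 with hs | hs
  · rw [truncPow_of_nonpos hs, truncPow_of_nonpos (mul_nonpos_of_nonneg_of_nonpos hc.le hs),
      mul_zero]
  · rw [truncPow_of_pos hs, truncPow_of_pos (mul_pos hc hs), Real.mul_rpow hc.le hs.le]

/-- The squared `L²`-norm of `s₊ ^ a - (s - 1)₊ ^ a`. -/
noncomputable def kernelNormSq (a : ℝ) : ℝ :=
  Real.Gamma (a + 1) * Real.Gamma (1 - 2 * a) / Real.Gamma (1 - a) / (2 * a + 1)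

theorem integrableOn_and_integral_Ioc_rpow_sq {a : ℝ} (ha0 : -(1 / 2) < a) :
    IntegrableOn (fun s : ℝ => (s ^ a) ^ 2) (Set.Ioc 0 1) ∧
      ∫ s in Set.Ioc (0 : ℝ) 1, (s ^ a) ^ 2 = 1 / (2 * a + 1) := by
  have hcongr : Set.EqOn (fun s : ℝ => s ^ (2 * a)) (fun s : ℝ => (s ^ a) ^ 2)
      (Set.Ioc 0 1) := fun s hs => by
    simp only
    rw [sq, two_mul, Real.rpow_add hs.1]
  have h := intervalIntegral.intervalIntegrable_rpow' (a := 0) (b := 1) (r := 2 * a) (by linarith)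
  rw [intervalIntegrable_iff_integrableOn_Ioc_of_le zero_le_one] at h
  refine ⟨h.congr_fun hcongr measurableSet_Ioc, ?_⟩
  rw [← setIntegral_congr_fun measurableSet_Ioc hcongr,
    ← intervalIntegral.integral_of_le zero_le_one, integral_rpow (Or.inl (by linarith)),
    Real.one_rpow, Real.zero_rpow (by linarith), sub_zero]

theorem integrable_and_integral_truncPow_unit {a : ℝ} (ha0 : -(1 / 2) < a) (ha1 : a < 1 / 2) :
    Integrable (fun s : ℝ => (truncPow a s - truncPow a (s - 1)) ^ 2) ∧
      ∫ s, (truncPow a s - truncPow a (s - 1)) ^ 2 = kernelNormSq a := by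
  set F : ℝ → ℝ := fun s => (truncPow a s - truncPow a (s - 1)) ^ 2 with hF
  obtain ⟨hi, hv⟩ := integrableOn_and_integral_Ioi_kernel ha0 ha1
  obtain ⟨hi', hv'⟩ := integrableOn_and_integral_Ioc_rpow_sq ha0
  have e0 : Set.EqOn F 0 (Set.Iic 0) := fun s hs => by
    have hs : s ≤ 0 := hs
    simp [hF, truncPow_of_nonpos hs, truncPow_of_nonpos (show s - 1 ≤ 0 by linarith)]
  have e1 : Set.EqOn (fun s : ℝ => (s ^ a) ^ 2) F (Set.Ioc 0 1) := fun s hs => by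
    simp [hF, truncPow_of_pos hs.1, truncPow_of_nonpos (sub_nonpos.2 hs.2)]
  have e2 : Set.EqOn (fun x : ℝ => ((1 + x) ^ a - x ^ a) ^ 2) (fun x => F (x + 1)) (Set.Ioi 0) :=
    fun x hx => by
      have hx : 0 < x := hx
      simp [hF, truncPow_of_pos hx, truncPow_of_pos (show 0 < x + 1 by positivity), add_comm]
  have hpre : (fun x : ℝ => x + 1) ⁻¹' Set.Ioi 1 = Set.Ioi 0 := by ext; simp
  have hmp := measurePreserving_add_right (volume : Measure ℝ) 1
  have hme := measurableEmbedding_addRight (1 : ℝ)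
  have i0 : IntegrableOn F (Set.Iic 0) :=
    (integrableOn_zero).congr_fun e0.symm measurableSet_Iic
  have i1 : IntegrableOn F (Set.Ioc 0 1) := hi'.congr_fun e1 measurableSet_Ioc
  have i2 : IntegrableOn F (Set.Ioi 1) := by
    rw [← hmp.integrableOn_comp_preimage hme, hpre]
    exact hi.congr_fun e2 measurableSet_Ioi
  have v0 : ∫ s in Set.Iic 0, F s = 0 := by
    rw [setIntegral_congr_fun measurableSet_Iic e0]; simp
  have v1 : ∫ s in Set.Ioc 0 1, F s = 1 / (2 * a + 1) := by
    rw [← setIntegral_congr_fun measurableSet_Ioc e1, hv']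
  have v2 : ∫ s in Set.Ioi 1, F s = ∫ x in Set.Ioi (0 : ℝ), ((1 + x) ^ a - x ^ a) ^ 2 := by
    rw [← hmp.setIntegral_preimage_emb hme, hpre, setIntegral_congr_fun measurableSet_Ioi e2]
  have i12 : IntegrableOn F (Set.Ioi 0) := by
    rw [← Set.Ioc_union_Ioi_eq_Ioi zero_le_one]
    exact i1.union i2
  have hI : Integrable F := by
    rw [← integrableOn_univ, ← Set.Iic_union_Ioi (a := (0 : ℝ))]
    exact i0.union i12
  refine ⟨hI, ?_⟩
  rw [← intervalIntegral.integral_Iic_add_Ioi i0 i12, v0, ← Set.Ioc_union_Ioi_eq_Ioi zero_le_one,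
    setIntegral_union (Set.Ioc_disjoint_Ioi le_rfl) measurableSet_Ioi i1 i2, v1, v2, kernelNormSq]
  have hne : 2 * a + 1 ≠ 0 := by linarith
  rw [eq_div_iff hne]
  linear_combination hv + mul_inv_cancel₀ hne

theorem integrable_and_integral_truncPow_of_lt {a u v : ℝ} (ha0 : -(1 / 2) < a) (ha1 : a < 1 / 2)
    (huv : u < v) :
    Integrable (fun s : ℝ => (truncPow a (s - u) - truncPow a (s - v)) ^ 2) ∧
      ∫ s, (truncPow a (s - u) - truncPow a (s - v)) ^ 2 =
        (v - u) ^ (2 * a + 1) * kernelNormSq a := by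
  obtain ⟨hi, hv⟩ := integrable_and_integral_truncPow_unit ha0 ha1
  set F : ℝ → ℝ := fun s => (truncPow a s - truncPow a (s - 1)) ^ 2 with hF
  have hc : 0 < v - u := sub_pos.2 huv
  have hfun : (fun s : ℝ => (truncPow a (s - u) - truncPow a (s - v)) ^ 2) =
      fun s => (v - u) ^ (2 * a) * F ((s - u) / (v - u)) := by
    funext s
    have h1 : s - u = (v - u) * ((s - u) / (v - u)) := by field_simp
    have h2 : s - v = (v - u) * ((s - u) / (v - u) - 1) := by field_simp; ring
    have h3 : truncPow a (s - u) = (v - u) ^ a * truncPow a ((s - u) / (v - u)) := by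
      rw [← truncPow_mul hc, ← h1]
    have h4 : truncPow a (s - v) = (v - u) ^ a * truncPow a ((s - u) / (v - u) - 1) := by
      rw [← truncPow_mul hc, ← h2]
    rw [h3, h4, hF, two_mul, Real.rpow_add hc]
    ring
  rw [hfun]
  refine ⟨((hi.comp_div hc.ne').comp_sub_right u).const_mul _, ?_⟩
  rw [integral_const_mul, integral_sub_right_eq_self (fun s => F (s / (v - u))) u,
    Measure.integral_comp_div F (v - u), hv, abs_of_pos hc, smul_eq_mul, Real.rpow_add_one hc.ne']
  ring

theorem integrable_and_integral_truncPow {a : ℝ} (ha0 : -(1 / 2) < a) (ha1 : a < 1 / 2)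
    (u v : ℝ) :
    Integrable (fun s : ℝ => (truncPow a (s - u) - truncPow a (s - v)) ^ 2) ∧
      ∫ s, (truncPow a (s - u) - truncPow a (s - v)) ^ 2 =
        |u - v| ^ (2 * a + 1) * kernelNormSq a := by
  rcases lt_trichotomy u v with h | rfl | h
  · rw [abs_sub_comm, abs_of_pos (sub_pos.2 h)]
    exact integrable_and_integral_truncPow_of_lt ha0 ha1 h
  · simp [Real.zero_rpow (show 2 * a + 1 ≠ 0 by linarith)]
  · rw [abs_of_pos (sub_pos.2 h)]
    have := integrable_and_integral_truncPow_of_lt ha0 ha1 h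
    have hs : (fun s : ℝ => (truncPow a (s - u) - truncPow a (s - v)) ^ 2) =
        fun s : ℝ => (truncPow a (s - v) - truncPow a (s - u)) ^ 2 := by
      funext s; ring
    rwa [hs]

/-- The moving-average kernel of the unit increment over `[k, k + 1]`, with time reversed. -/
noncomputable def noiseKernel (a : ℝ) (k : ℕ) (s : ℝ) : ℝ :=
  truncPow a (s - k) - truncPow a (s - (k + 1))

/-- The autocovariance at lag `x` of fractional Gaussian noise with Hurst index `H`. -/
noncomputable def noiseAutocov (H x : ℝ) : ℝ :=
  (|x - 1| ^ (2 * H) + |x + 1| ^ (2 * H) - 2 * |x| ^ (2 * H)) / 2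

theorem integrable_and_integral_noiseKernel_mul {a : ℝ} (ha0 : -(1 / 2) < a) (ha1 : a < 1 / 2)
    (j k : ℕ) :
    Integrable (fun s : ℝ => noiseKernel a j s * noiseKernel a k s) ∧
      ∫ s, noiseKernel a j s * noiseKernel a k s =
        noiseAutocov (a + 1 / 2) ((j : ℝ) - k) * kernelNormSq a := by
  obtain ⟨i1, v1⟩ := integrable_and_integral_truncPow ha0 ha1 j (k + 1)
  obtain ⟨i2, v2⟩ := integrable_and_integral_truncPow ha0 ha1 (j + 1) k
  obtain ⟨i3, v3⟩ := integrable_and_integral_truncPow ha0 ha1 j k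
  obtain ⟨i4, v4⟩ := integrable_and_integral_truncPow ha0 ha1 (j + 1) (k + 1)
  have hfun : (fun s : ℝ => noiseKernel a j s * noiseKernel a k s) = fun s => (1 / 2) *
      (((truncPow a (s - j) - truncPow a (s - (k + 1))) ^ 2 +
        (truncPow a (s - (j + 1)) - truncPow a (s - k)) ^ 2) -
       ((truncPow a (s - j) - truncPow a (s - k)) ^ 2 +
        (truncPow a (s - (j + 1)) - truncPow a (s - (k + 1))) ^ 2)) := by
    funext s
    unfold noiseKernel
    ring
  rw [hfun]
  refine ⟨((i1.add i2).sub (i3.add i4)).const_mul _, ?_⟩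
  rw [integral_const_mul, integral_sub (i1.fun_add i2) (i3.fun_add i4), integral_add i1 i2,
    integral_add i3 i4, v1, v2, v3, v4, noiseAutocov]
  have h1 : (j : ℝ) - (k + 1) = j - k - 1 := by ring
  have h2 : (j : ℝ) + 1 - k = j - k + 1 := by ring
  have h3 : (j : ℝ) + 1 - (k + 1) = j - k := by ring
  have h4 : 2 * (a + 1 / 2) = 2 * a + 1 := by ring
  rw [h1, h2, h3, h4]
  ring

/-- The covariance matrix of the first `n` terms of fractional Gaussian noise. -/
noncomputable def noiseCov (H : ℝ) (n : ℕ) : Matrix (Fin n) (Fin n) ℝ :=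
  Matrix.of fun i j => noiseAutocov H ((i : ℝ) - (j : ℝ))

theorem integrable_and_integral_sq_sum_noiseKernel {a : ℝ} (ha0 : -(1 / 2) < a) (ha1 : a < 1 / 2)
    {n : ℕ} (v : Fin n → ℝ) :
    Integrable (fun s : ℝ => (∑ i, v i * noiseKernel a i s) ^ 2) ∧
      ∫ s, (∑ i, v i * noiseKernel a i s) ^ 2 =
        v ⬝ᵥ (noiseCov (a + 1 / 2) n).mulVec v * kernelNormSq a := by
  have h := fun i j : Fin n => integrable_and_integral_noiseKernel_mul ha0 ha1 (i : ℕ) (j : ℕ)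
  have hfun : (fun s : ℝ => (∑ i, v i * noiseKernel a i s) ^ 2) = fun s => ∑ i, ∑ j,
      v i * v j * (noiseKernel a i s * noiseKernel a j s) := by
    funext s
    rw [sq, Finset.sum_mul_sum]
    refine Finset.sum_congr rfl fun i _ => Finset.sum_congr rfl fun j _ => ?_
    ring
  rw [hfun]
  have hi : ∀ i j : Fin n, Integrable fun s : ℝ =>
      v i * v j * (noiseKernel a i s * noiseKernel a j s) := fun i j => (h i j).1.const_mul _
  refine ⟨integrable_finsetSum _ fun i _ => integrable_finsetSum _ fun j _ => hi i j, ?_⟩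
  rw [integral_finsetSum _ fun i _ => integrable_finsetSum _ fun j _ => hi i j]
  simp_rw [integral_finsetSum _ fun j _ => hi _ j, integral_const_mul, (h _ _).2]
  simp only [dotProduct, Matrix.mulVec, noiseCov, Matrix.of_apply, Finset.mul_sum, Finset.sum_mul]
  refine Finset.sum_congr rfl fun i _ => Finset.sum_congr rfl fun j _ => ?_
  ring

theorem sq_div_le_quadForm {a : ℝ} (ha0 : -(1 / 2) < a) (ha1 : a < 1 / 2)
    {n : ℕ} (v : Fin n → ℝ) (k : Fin n) (hk : ∀ i < k, v i = 0) :
    v k ^ 2 / (2 * a + 1) ≤ v ⬝ᵥ (noiseCov (a + 1 / 2) n).mulVec v * kernelNormSq a := by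
  obtain ⟨hi, hv⟩ := integrable_and_integral_sq_sum_noiseKernel ha0 ha1 v
  rw [← hv]
  refine le_trans (le_of_eq ?_)
    (setIntegral_le_integral (s := Set.Ioc (k : ℝ) (k + 1)) hi (ae_of_all _ fun s => sq_nonneg _))
  have hcongr : Set.EqOn (fun s : ℝ => (∑ i, v i * noiseKernel a i s) ^ 2)
      (fun s => v k ^ 2 * ((s - (k : ℝ)) ^ a) ^ 2) (Set.Ioc (k : ℝ) (k + 1)) := by
    intro s hs
    have hsum : ∑ i, v i * noiseKernel a i s = v k * (s - (k : ℝ)) ^ a := by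
      rw [Finset.sum_eq_single k]
      · rw [noiseKernel, truncPow_of_pos (sub_pos.2 hs.1), truncPow_of_nonpos (sub_nonpos.2 hs.2),
          sub_zero]
      · intro i _ hik
        rcases lt_or_gt_of_ne hik with h | h
        · rw [hk i h, zero_mul]
        · have h' : (k : ℝ) + 1 ≤ i := by exact_mod_cast h
          rw [noiseKernel, truncPow_of_nonpos (by linarith [hs.2]),
            truncPow_of_nonpos (by linarith [hs.2]), sub_zero, mul_zero]
      · simp
    simp only [hsum, mul_pow]
  have hpre : (fun x : ℝ => x + (k : ℝ)) ⁻¹' Set.Ioc (k : ℝ) (k + 1) = Set.Ioc 0 1 := by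
    ext x; simp
  rw [setIntegral_congr_fun measurableSet_Ioc hcongr, integral_const_mul,
    ← (measurePreserving_add_right (volume : Measure ℝ) (k : ℝ)).setIntegral_preimage_emb
      (measurableEmbedding_addRight (k : ℝ)), hpre]
  simp only [add_sub_cancel_right]
  rw [(integrableOn_and_integral_Ioc_rpow_sq ha0).2]
  ring

theorem sigmaSq_pos {H : ℝ} (hH0 : 0 < H) (hH1 : H < 1) : 0 < sigmaSq H :=
  div_pos (Real.Gamma_pos_of_pos (by linarith))
    (mul_pos (Real.Gamma_pos_of_pos (by linarith)) (Real.Gamma_pos_of_pos (by linarith)))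

theorem sigmaSq_mul_sq_le_quadForm {H : ℝ} (hH0 : 0 < H) (hH1 : H < 1)
    {n : ℕ} (v : Fin n → ℝ) (k : Fin n) (hk : ∀ i < k, v i = 0) :
    sigmaSq H * v k ^ 2 ≤ v ⬝ᵥ (noiseCov H n).mulVec v := by
  have h := sq_div_le_quadForm (a := H - 1 / 2) (by linarith) (by linarith) v k hk
  have hσ := sigmaSq_pos hH0 hH1
  have hK : kernelNormSq (H - 1 / 2) = 1 / (2 * H * sigmaSq H) := by
    have h1 : H - 1 / 2 + 1 = H + 1 / 2 := by ring
    have h2 : 1 - 2 * (H - 1 / 2) = 2 - 2 * H := by ring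
    have h3 : 1 - (H - 1 / 2) = 3 / 2 - H := by ring
    have h4 : 2 * (H - 1 / 2) + 1 = 2 * H := by ring
    have g1 := Real.Gamma_pos_of_pos (show 0 < H + 1 / 2 by linarith)
    have g2 := Real.Gamma_pos_of_pos (show 0 < 2 - 2 * H by linarith)
    have g3 := Real.Gamma_pos_of_pos (show 0 < 3 / 2 - H by linarith)
    rw [kernelNormSq, sigmaSq, h1, h2, h3, h4]
    field_simp
  have h4 : 2 * (H - 1 / 2) + 1 = 2 * H := by ring
  rw [hK, h4, show H - 1 / 2 + 1 / 2 = H by ring, mul_one_div, div_le_div_iff₀ (by positivity)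
    (by positivity)] at h
  refine le_of_mul_le_mul_right ?_ (show 0 < 2 * H by positivity)
  linarith

end MovingAverage

section PredictionError

theorem Matrix.PosDef.exists_quadForm_eq_det_div {n : ℕ}
    {A : Matrix (Fin (n + 1)) (Fin (n + 1)) ℝ} (hA : A.PosDef)
    (hA' : 0 < (A.submatrix Fin.succ Fin.succ).det) :
    ∃ w : Fin (n + 1) → ℝ, w 0 = 1 ∧
      w ⬝ᵥ A.mulVec w = A.det / (A.submatrix Fin.succ Fin.succ).det ∧
      ∀ v : Fin (n + 1) → ℝ, v 0 = 1 →
        A.det / (A.submatrix Fin.succ Fin.succ).det ≤ v ⬝ᵥ A.mulVec v := by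
  set D := (A.submatrix Fin.succ Fin.succ).det with hD
  set w : Fin (n + 1) → ℝ := D⁻¹ • A.adjugate.mulVec (Pi.single 0 1) with hw
  have hAw : A.mulVec w = (A.det / D) • Pi.single 0 1 := by
    rw [hw, Matrix.mulVec_smul, Matrix.mulVec_mulVec, Matrix.mul_adjugate, Matrix.smul_mulVec,
      Matrix.one_mulVec, smul_smul, div_eq_inv_mul]
  have hw0 : w 0 = 1 := by
    have h00 : A.adjugate 0 0 = D := by
      rw [Matrix.adjugate_fin_succ_eq_det_submatrix]
      simp [hD, Fin.succAbove_zero]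
    simp [hw, h00, hA'.ne']
  have hvw : ∀ v : Fin (n + 1) → ℝ, v 0 = 1 → v ⬝ᵥ A.mulVec w = A.det / D := by
    intro v hv
    simp [hAw, hv]
  refine ⟨w, hw0, hvw w hw0, fun v hv => ?_⟩
  have hsymm : w ⬝ᵥ A.mulVec v = v ⬝ᵥ A.mulVec w := by
    have hT : A.transpose = A := by
      simpa [Matrix.conjTranspose_eq_transpose_of_trivial] using hA.isHermitian.eq
    rw [Matrix.dotProduct_mulVec, ← Matrix.mulVec_transpose, hT, dotProduct_comm]
  have hnn : 0 ≤ (v - w) ⬝ᵥ A.mulVec (v - w) := by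
    simpa using hA.posSemidef.dotProduct_mulVec_nonneg (v - w)
  rw [Matrix.mulVec_sub, dotProduct_sub, sub_dotProduct, sub_dotProduct, hsymm, hvw v hv,
    hvw w hw0] at hnn
  linarith

theorem noiseAutocov_neg (H x : ℝ) : noiseAutocov H (-x) = noiseAutocov H x := by
  have h1 : |-x - 1| = |x + 1| := by rw [← abs_neg]; ring_nf
  have h2 : |-x + 1| = |x - 1| := by rw [← abs_neg]; ring_nf
  rw [noiseAutocov, noiseAutocov, h1, h2, abs_neg]
  ring

theorem posDef_noiseCov {H : ℝ} (hH0 : 0 < H) (hH1 : H < 1) (n : ℕ) : (noiseCov H n).PosDef := by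
  refine Matrix.PosDef.of_dotProduct_mulVec_pos ?_ fun v hv => ?_
  · ext i j
    simp only [noiseCov, Matrix.conjTranspose_apply, Matrix.of_apply, star_trivial]
    rw [← noiseAutocov_neg, neg_sub]
  · have hne : (Finset.univ.filter fun i => v i ≠ 0).Nonempty := by
      obtain ⟨i, hi⟩ := Function.ne_iff.1 hv
      exact ⟨i, by simpa using hi⟩
    set k := (Finset.univ.filter fun i => v i ≠ 0).min' hne with hk
    have hvk : v k ≠ 0 := by
      have := Finset.min'_mem _ hne
      simpa using (Finset.mem_filter.1 this).2
    have hlt : ∀ i < k, v i = 0 := by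
      intro i hi
      by_contra h
      exact absurd (Finset.min'_le _ i (by simpa using h)) (not_le.2 hi)
    have := sigmaSq_mul_sq_le_quadForm hH0 hH1 v k hlt
    have hσ := sigmaSq_pos hH0 hH1
    rw [star_trivial]
    exact lt_of_lt_of_le (by positivity) this

theorem submatrix_succ_noiseCov (H : ℝ) (n : ℕ) :
    (noiseCov H (n + 1)).submatrix Fin.succ Fin.succ = noiseCov H n := by
  ext i j
  simp [noiseCov]

/-- The one-step prediction error of fractional Gaussian noise from `n` neighbouring terms. -/
noncomputable def predictionError (H : ℝ) (n : ℕ) : ℝ :=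
  (noiseCov H (n + 1)).det / (noiseCov H n).det

theorem exists_quadForm_eq_predictionError {H : ℝ} (hH0 : 0 < H) (hH1 : H < 1) (n : ℕ) :
    ∃ w : Fin (n + 1) → ℝ, w 0 = 1 ∧
      w ⬝ᵥ (noiseCov H (n + 1)).mulVec w = predictionError H n ∧
      ∀ v : Fin (n + 1) → ℝ, v 0 = 1 →
        predictionError H n ≤ v ⬝ᵥ (noiseCov H (n + 1)).mulVec v := by
  have h := (posDef_noiseCov hH0 hH1 (n + 1)).exists_quadForm_eq_det_div
  rw [submatrix_succ_noiseCov] at h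
  exact h (posDef_noiseCov hH0 hH1 n).det_pos

theorem sigmaSq_le_predictionError {H : ℝ} (hH0 : 0 < H) (hH1 : H < 1) (n : ℕ) :
    sigmaSq H ≤ predictionError H n := by
  obtain ⟨w, hw0, hw, -⟩ := exists_quadForm_eq_predictionError hH0 hH1 n
  have := sigmaSq_mul_sq_le_quadForm hH0 hH1 w 0 fun i hi => absurd hi (Fin.not_lt_zero i)
  rwa [hw0, one_pow, mul_one, hw] at this

theorem antitone_predictionError {H : ℝ} (hH0 : 0 < H) (hH1 : H < 1) :
    Antitone (predictionError H) := by
  refine antitone_nat_of_succ_le fun n => ?_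
  obtain ⟨w, hw0, hw, -⟩ := exists_quadForm_eq_predictionError hH0 hH1 n
  obtain ⟨-, -, -, hmin⟩ := exists_quadForm_eq_predictionError hH0 hH1 (n + 1)
  rw [← hw]
  refine (hmin (Fin.snoc (α := fun _ => ℝ) w 0) ?_).trans (le_of_eq ?_)
  · rw [← hw0, ← Fin.castSucc_zero, Fin.snoc_castSucc]
  · simp [dotProduct, Matrix.mulVec, Fin.sum_univ_castSucc (n := n + 1), noiseCov]

theorem log_det_noiseCov {H : ℝ} (hH0 : 0 < H) (hH1 : H < 1) (n : ℕ) :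
    Real.log (noiseCov H n).det = ∑ k ∈ Finset.range n, Real.log (predictionError H k) := by
  induction n with
  | zero => simp
  | succ n ih =>
    rw [Finset.sum_range_succ, ← ih, predictionError,
      Real.log_div (posDef_noiseCov hH0 hH1 (n + 1)).det_pos.ne'
        (posDef_noiseCov hH0 hH1 n).det_pos.ne']
    ring

theorem mul_log_sigmaSq_le_log_det {H : ℝ} (hH0 : 0 < H) (hH1 : H < 1) (n : ℕ) :
    n * Real.log (sigmaSq H) ≤ Real.log (noiseCov H n).det := by
  rw [log_det_noiseCov hH0 hH1]
  have := Finset.card_nsmul_le_sum (Finset.range n) (fun k => Real.log (predictionError H k))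
    (Real.log (sigmaSq H)) fun k _ =>
      Real.log_le_log (sigmaSq_pos hH0 hH1) (sigmaSq_le_predictionError hH0 hH1 k)
  simpa using this

theorem exists_tendsto_log_det_noiseCov {H : ℝ} (hH0 : 0 < H) (hH1 : H < 1) :
    ∃ l : ℝ, Real.log (sigmaSq H) ≤ l ∧
      Tendsto (fun n : ℕ => Real.log (noiseCov H n).det / n) atTop (𝓝 l) := by
  have hle : ∀ k, Real.log (sigmaSq H) ≤ Real.log (predictionError H k) := fun k =>
    Real.log_le_log (sigmaSq_pos hH0 hH1) (sigmaSq_le_predictionError hH0 hH1 k)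
  have hanti : Antitone fun k => Real.log (predictionError H k) := fun i j hij =>
    Real.log_le_log ((sigmaSq_pos hH0 hH1).trans_le (sigmaSq_le_predictionError hH0 hH1 j))
      (antitone_predictionError hH0 hH1 hij)
  have ht := tendsto_atTop_ciInf hanti ⟨_, Set.forall_mem_range.2 hle⟩
  refine ⟨_, le_ciInf hle, ?_⟩
  refine ht.cesaro.congr fun n => ?_
  rw [log_det_noiseCov hH0 hH1, div_eq_inv_mul]

end PredictionError

section GaussianEntropy

theorem pi_gaussianReal_eq_withDensity (n : ℕ) :
    Measure.pi (fun _ : Fin n => gaussianReal 0 1) =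
      volume.withDensity fun x => ENNReal.ofReal (∏ i, gaussianPDFReal 0 1 (x i)) := by
  refine Measure.pi_eq fun s hs => ?_
  have hi : ∀ i, Integrable (gaussianPDFReal 0 1) (volume.restrict (s i)) := fun i =>
    (integrable_gaussianPDFReal 0 1).restrict
  rw [withDensity_apply _ (MeasurableSet.univ_pi hs), volume_pi, Measure.restrict_pi_pi,
    ← ofReal_integral_eq_lintegral_ofReal (Integrable.fintype_prod hi)
      (ae_of_all _ fun x => Finset.prod_nonneg fun i _ => gaussianPDFReal_nonneg 0 1 _),
    integral_fintype_prod_eq_prod, ENNReal.ofReal_prod_of_nonneg fun i _ =>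
      integral_nonneg fun x => gaussianPDFReal_nonneg 0 1 x]
  exact Finset.prod_congr rfl fun i _ => (gaussianReal_apply_eq_integral 0 one_ne_zero (s i)).symm

theorem map_mulVec_withDensity {n : ℕ} {A : Matrix (Fin n) (Fin n) ℝ} (hA : A.det ≠ 0)
    {f : (Fin n → ℝ) → ℝ} (hf : Measurable f) :
    (volume.withDensity fun x => ENNReal.ofReal (f x)).map A.mulVec =
      volume.withDensity fun x => ENNReal.ofReal (|A.det|⁻¹ * f (A⁻¹.mulVec x)) := by
  have hmv : ∀ M : Matrix (Fin n) (Fin n) ℝ, Measurable M.mulVec := fun M =>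
    (Continuous.matrix_mulVec continuous_const continuous_id).measurable
  have hvol := Real.map_matrix_volume_pi_eq_smul_volume_pi hA
  have hcoe : ⇑(Matrix.toLin' A) = A.mulVec := by ext1 x; exact Matrix.toLin'_apply A x
  rw [hcoe] at hvol
  ext s hs
  rw [Measure.map_apply (hmv A) hs, withDensity_apply _ (hmv A hs), withDensity_apply _ hs]
  have hg : Measurable fun x => ENNReal.ofReal (f (A⁻¹.mulVec x)) :=
    (hf.comp (hmv A⁻¹)).ennreal_ofReal
  have hu : IsUnit A.det := isUnit_iff_ne_zero.2 hA
  calc ∫⁻ x in A.mulVec ⁻¹' s, ENNReal.ofReal (f x)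
      = ∫⁻ x in A.mulVec ⁻¹' s, ENNReal.ofReal (f (A⁻¹.mulVec (A.mulVec x))) := by
        simp [Matrix.mulVec_mulVec, Matrix.nonsing_inv_mul A hu]
    _ = ∫⁻ y in s, ENNReal.ofReal (f (A⁻¹.mulVec y)) ∂(volume.map A.mulVec) :=
        (setLIntegral_map hs hg (hmv A)).symm
    _ = ENNReal.ofReal |A.det|⁻¹ * ∫⁻ y in s, ENNReal.ofReal (f (A⁻¹.mulVec y)) := by
        rw [hvol, Measure.restrict_smul, lintegral_smul_measure, abs_inv, smul_eq_mul]
    _ = _ := by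
        rw [← lintegral_const_mul _ hg]
        simp_rw [ENNReal.ofReal_mul (inv_nonneg.2 (abs_nonneg A.det))]

theorem log_gaussianPDFReal_zero_one (x : ℝ) :
    Real.log (gaussianPDFReal 0 1 x) = -(Real.log (2 * Real.pi) / 2) - x ^ 2 / 2 := by
  have hpi : 0 < 2 * Real.pi := by positivity
  rw [gaussianPDFReal, Real.log_mul (by positivity) (Real.exp_ne_zero _), Real.log_exp,
    Real.log_inv, Real.log_sqrt (by positivity)]
  simp
  ring

open scoped MatrixOrder in
theorem Matrix.PosDef.exists_eq_mul_transpose {n : ℕ} {S : Matrix (Fin n) (Fin n) ℝ}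
    (hS : S.PosDef) : ∃ A : Matrix (Fin n) (Fin n) ℝ, A.det ≠ 0 ∧ S = A * A.transpose := by
  obtain ⟨B, hB⟩ := CStarAlgebra.nonneg_iff_eq_star_mul_self.mp hS.posSemidef.nonneg
  have hB' : S = B.transpose * B := by
    rw [hB, Matrix.star_eq_conjTranspose, Matrix.conjTranspose_eq_transpose_of_trivial]
  refine ⟨B.transpose, fun h => ?_, by rw [Matrix.transpose_transpose, hB']⟩
  have := hS.det_pos
  rw [hB', Matrix.det_mul, h, zero_mul] at this
  exact lt_irrefl _ this

variable {Ω : Type*} [MeasurableSpace Ω] {P : Measure Ω} {n : ℕ} {ξ : Ω → Fin n → ℝ}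

theorem map_eq_pi_gaussianReal (hξ : HasGaussianLaw ξ P) (hmean : ∀ i, ∫ ω, ξ ω i ∂P = 0)
    (hcov : ∀ i j, ∫ ω, ξ ω i * ξ ω j ∂P = (1 : Matrix (Fin n) (Fin n) ℝ) i j) :
    P.map ξ = Measure.pi fun _ : Fin n => gaussianReal 0 1 := by
  have := hξ.isProbabilityMeasure
  have hξ' : HasGaussianLaw (fun ω => (fun i => ξ ω i)) P := hξ
  have hev : ∀ i, HasGaussianLaw (fun ω => ξ ω i) P := fun i =>
    HasGaussianLaw.eval (X := fun i ω => ξ ω i) hξ' i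
  have hc : ∀ i j, cov[fun ω => ξ ω i, fun ω => ξ ω j; P] = (1 : Matrix (Fin n) (Fin n) ℝ) i j := by
    intro i j
    rw [covariance_eq_sub (hev i).memLp_two (hev j).memLp_two, hmean, hmean, mul_zero, sub_zero,
      ← hcov i j]
    rfl
  have hind : iIndepFun (fun i ω => ξ ω i) P :=
    HasGaussianLaw.iIndepFun_of_covariance_eq_zero (X := fun i ω => ξ ω i) hξ' fun i j hij => by
      rw [hc, Matrix.one_apply_ne hij]
  rw [iIndepFun_iff_map_fun_eq_pi_map fun i => (hev i).aemeasurable] at hind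
  refine hind.trans (congrArg _ (funext fun i => ?_))
  rw [(hev i).map_eq_gaussianReal, hmean, ← covariance_self (hev i).aemeasurable, hc,
    Matrix.one_apply_eq, Real.toNNReal_one]

theorem integral_mulVec_mul_mulVec (hInt : ∀ i j, Integrable (fun ω => ξ ω i * ξ ω j) P)
    {S : Matrix (Fin n) (Fin n) ℝ} (hcov : ∀ i j, ∫ ω, ξ ω i * ξ ω j ∂P = S i j)
    (C : Matrix (Fin n) (Fin n) ℝ) (i j : Fin n) :
    ∫ ω, C.mulVec (ξ ω) i * C.mulVec (ξ ω) j ∂P = (C * S * C.transpose) i j := by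
  have hfun : (fun ω => C.mulVec (ξ ω) i * C.mulVec (ξ ω) j) =
      fun ω => ∑ l, ∑ k, C i k * C j l * (ξ ω k * ξ ω l) := by
    funext ω
    rw [Finset.sum_comm]
    simp only [Matrix.mulVec, dotProduct, Finset.sum_mul_sum]
    exact Finset.sum_congr rfl fun k _ => Finset.sum_congr rfl fun l _ => by ring
  rw [hfun, integral_finsetSum _ fun l _ => integrable_finsetSum _ fun k _ =>
    (hInt k l).const_mul _]
  simp_rw [integral_finsetSum _ fun k _ => (hInt k _).const_mul _, integral_const_mul, hcov,
    Matrix.mul_apply, Matrix.transpose_apply, Finset.sum_mul]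
  exact Finset.sum_congr rfl fun l _ => Finset.sum_congr rfl fun k _ => by ring

theorem hasEntropy_and_entropy_of_gaussian (hξ : HasGaussianLaw ξ P)
    (hmean : ∀ i, ∫ ω, ξ ω i ∂P = 0) {S : Matrix (Fin n) (Fin n) ℝ} (hS : S.PosDef)
    (hcov : ∀ i j, ∫ ω, ξ ω i * ξ ω j ∂P = S i j) :
    HasEntropy ξ P ∧
      entropy ξ P = n / 2 * (1 + Real.log (2 * Real.pi)) + Real.log S.det / 2 := by
  have := hξ.isProbabilityMeasure
  obtain ⟨A, hA, rfl⟩ := hS.exists_eq_mul_transpose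
  have hu : IsUnit A.det := isUnit_iff_ne_zero.2 hA
  have hev : ∀ {η : Ω → Fin n → ℝ}, HasGaussianLaw η P → ∀ i, HasGaussianLaw (fun ω => η ω i) P :=
    fun {η} h i => HasGaussianLaw.eval (X := fun i ω => η ω i) h i
  set η : Ω → Fin n → ℝ := fun ω => A⁻¹.mulVec (ξ ω) with hη
  have hηG : HasGaussianLaw η P :=
    hξ.map_fun (LinearMap.toContinuousLinearMap (Matrix.mulVecLin A⁻¹))
  have hηmean : ∀ i, ∫ ω, η ω i ∂P = 0 := by
    intro i
    simp only [hη, Matrix.mulVec, dotProduct]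
    rw [integral_finsetSum _ fun j _ => (hev hξ j).integrable.const_mul _]
    simp [integral_const_mul, hmean]
  have hηcov : ∀ i j, ∫ ω, η ω i * η ω j ∂P = (1 : Matrix (Fin n) (Fin n) ℝ) i j := by
    intro i j
    rw [integral_mulVec_mul_mulVec
      (fun k l => (hev hξ k).memLp_two.integrable_mul (hev hξ l).memLp_two) hcov A⁻¹ i j]
    rw [← Matrix.mul_assoc, Matrix.nonsing_inv_mul A hu, Matrix.one_mul, ← Matrix.transpose_mul,
      Matrix.nonsing_inv_mul A hu, Matrix.transpose_one]
  have hξη : ξ = fun ω => A.mulVec (η ω) := by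
    funext ω
    simp [hη, Matrix.mulVec_mulVec, Matrix.mul_nonsing_inv A hu]
  have hmv : ∀ M : Matrix (Fin n) (Fin n) ℝ, Measurable M.mulVec := fun M =>
    (Continuous.matrix_mulVec continuous_const continuous_id).measurable
  set f : (Fin n → ℝ) → ℝ := fun x => ∏ i, gaussianPDFReal 0 1 (x i) with hf
  have hfm : Measurable f := Finset.measurable_prod _ fun i _ =>
    (measurable_gaussianPDFReal 0 1).comp (measurable_pi_apply i)
  set r : (Fin n → ℝ) → ℝ := fun x => |A.det|⁻¹ * f (A⁻¹.mulVec x) with hr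
  have hrm : Measurable r := (hfm.comp (hmv _)).const_mul _
  have hr0 : ∀ x, 0 < r x := fun x =>
    mul_pos (by positivity) (Finset.prod_pos fun i _ => gaussianPDFReal_pos 0 1 _ one_ne_zero)
  have hlaw : P.map ξ = volume.withDensity fun x => ENNReal.ofReal (r x) := by
    have h1 : P.map ξ = (P.map η).map A.mulVec := by
      rw [AEMeasurable.map_map_of_aemeasurable (hmv A).aemeasurable hηG.aemeasurable]
      exact congrArg (fun g => P.map g) hξη
    rw [h1, map_eq_pi_gaussianReal hηG hηmean hηcov, pi_gaussianReal_eq_withDensity,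
      map_mulVec_withDensity hA hfm]
  have hpdf : HasPDF ξ P volume :=
    hasPDF_of_map_eq_withDensity hξ.aemeasurable _ hrm.ennreal_ofReal.aemeasurable hlaw
  have hae : realDensity ξ P =ᵐ[volume] r := by
    filter_upwards [(pdf.eq_of_map_eq_withDensity _ hrm.ennreal_ofReal.aemeasurable).1 hlaw]
      with x hx
    rw [realDensity, hx, ENNReal.toReal_ofReal (hr0 x).le]
  have hae' : (fun x => realDensity ξ P x * Real.log (realDensity ξ P x)) =ᵐ[volume]
      fun x => (pdf ξ P volume x).toReal • Real.log (r x) := by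
    filter_upwards [hae] with x hx
    rw [hx, smul_eq_mul, ← hx]
    rfl
  have hlogm : AEStronglyMeasurable (fun x => Real.log (r x)) volume :=
    (Real.measurable_log.comp hrm).aestronglyMeasurable
  have hlog : (fun ω => Real.log (r (ξ ω))) = fun ω =>
      -Real.log |A.det| + ∑ i, (-(Real.log (2 * Real.pi) / 2) - η ω i * η ω i / 2) := by
    funext ω
    rw [hr, hf, Real.log_mul (by positivity)
      (Finset.prod_pos fun i _ => gaussianPDFReal_pos 0 1 _ one_ne_zero).ne', Real.log_inv,
      Real.log_prod fun i _ => (gaussianPDFReal_pos 0 1 _ one_ne_zero).ne']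
    simp only [log_gaussianPDFReal_zero_one, sq, hη]
  have hsq : ∀ i, Integrable (fun ω => η ω i * η ω i / 2) P := fun i =>
    ((hev hηG i).memLp_two.integrable_mul (hev hηG i).memLp_two).div_const 2
  have hterm : ∀ i ∈ (Finset.univ : Finset (Fin n)),
      Integrable (fun ω => -(Real.log (2 * Real.pi) / 2) - η ω i * η ω i / 2) P := fun i _ =>
    (integrable_const _).sub (hsq i)
  have hlogint : Integrable (fun ω => Real.log (r (ξ ω))) P := by
    rw [hlog]
    exact (integrable_const _).add (integrable_finsetSum _ hterm)
  refine ⟨⟨hpdf, ?_⟩, ?_⟩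
  · rw [integrable_congr hae', pdf.integrable_pdf_smul_iff hlogm]
    exact hlogint
  · rw [entropy, integral_congr_ae hae', pdf.integral_pdf_smul hlogm, hlog,
      integral_add (integrable_const _) (integrable_finsetSum _ hterm), integral_finsetSum _ hterm]
    have hone : ∀ i, ∫ ω, (-(Real.log (2 * Real.pi) / 2) - η ω i * η ω i / 2) ∂P =
        -(Real.log (2 * Real.pi) / 2) - 1 / 2 := by
      intro i
      rw [integral_sub (integrable_const _) (hsq i), integral_div, hηcov, Matrix.one_apply_eq]
      simp
    simp_rw [hone]
    have hdet : Real.log (A * A.transpose).det = 2 * Real.log |A.det| := by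
      rw [Matrix.det_mul, Matrix.det_transpose, Real.log_mul hA hA, Real.log_abs]
      ring
    rw [hdet]
    simp
    ring

end GaussianEntropy

section FractionalGaussianNoise

variable {Ω : Type*} [MeasurableSpace Ω] {P : Measure Ω} {H : ℝ} {B : ℝ≥0 → Ω → ℝ}

theorem hasGaussianLaw_initialVector_noise (hB : IsGaussianProcess B P) (n : ℕ) :
    HasGaussianLaw (initialVector (fractionalGaussianNoise B) n) P := by
  have h := hB.hasGaussianLaw_increments (n := n) (t := fun i : Fin (n + 1) => ((i : ℕ) : ℝ≥0))
  convert! h using 3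
  simp [initialVector, fractionalGaussianNoise]

theorem integral_noise (hB : IsFractionalBrownianMotion H B P) (k : ℕ) :
    ∫ ω, fractionalGaussianNoise B k ω ∂P = 0 := by
  have hi : ∀ t, Integrable (B t) P := fun t =>
    (hB.isGaussianProcess.hasGaussianLaw_eval t).integrable
  simp only [fractionalGaussianNoise]
  rw [integral_sub (hi _) (hi _), hB.centered, hB.centered, sub_zero]

theorem integral_noise_mul_noise (hB : IsFractionalBrownianMotion H B P) (j k : ℕ) :
    ∫ ω, fractionalGaussianNoise B j ω * fractionalGaussianNoise B k ω ∂P =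
      noiseAutocov H ((j : ℝ) - k) := by
  have hi : ∀ s t, Integrable (fun ω => B s ω * B t ω) P := fun s t =>
    (hB.isGaussianProcess.hasGaussianLaw_eval s).memLp_two.integrable_mul
      (hB.isGaussianProcess.hasGaussianLaw_eval t).memLp_two
  have hfun : (fun ω => fractionalGaussianNoise B j ω * fractionalGaussianNoise B k ω) =
      fun ω => (B (j + 1) ω * B (k + 1) ω + B j ω * B k ω) -
        (B (j + 1) ω * B k ω + B j ω * B (k + 1) ω) := by
    funext ω
    simp only [fractionalGaussianNoise]
    ring
  rw [hfun, integral_sub ((hi _ _).fun_add (hi _ _)) ((hi _ _).fun_add (hi _ _)),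
    integral_add (hi _ _) (hi _ _), integral_add (hi _ _) (hi _ _)]
  simp only [hB.covariance, noiseAutocov]
  push_cast
  have h1 : (j : ℝ) + 1 - (k + 1) = j - k := by ring
  have h2 : (j : ℝ) + 1 - k = j - k + 1 := by ring
  have h3 : (j : ℝ) - (k + 1) = j - k - 1 := by ring
  rw [h1, h2, h3]
  ring

theorem hasEntropy_and_entropy_noise (hH0 : 0 < H) (hH1 : H < 1)
    (hB : IsFractionalBrownianMotion H B P) (n : ℕ) :
    HasEntropy (initialVector (fractionalGaussianNoise B) n) P ∧
      entropy (initialVector (fractionalGaussianNoise B) n) P =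
        n / 2 * (1 + Real.log (2 * Real.pi)) + Real.log (noiseCov H n).det / 2 :=
  hasEntropy_and_entropy_of_gaussian (hasGaussianLaw_initialVector_noise hB.isGaussianProcess n)
    (fun i => integral_noise hB i) (posDef_noiseCov hH0 hH1 n)
    (fun i j => integral_noise_mul_noise hB i j)

end FractionalGaussianNoise

theorem mainTheorem2 {Ω : Type*} [MeasurableSpace Ω] (P : Measure Ω)
    (H : ℝ) (hH0 : 0 < H) (hH1 : H < 1)
    (B : ℝ≥0 → Ω → ℝ) (hB : IsFractionalBrownianMotion H B P) :
    (∀ n : ℕ, 1 ≤ n →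
      HasEntropy (initialVector (fractionalGaussianNoise B) n) P ∧
      entropy (initialVector (fractionalGaussianNoise B) n) P ≥
        (n : ℝ) / 2 * (1 + Real.log (2 * Real.pi) + Real.log (sigmaSq H))) ∧
    ∃ h : ℝ, IsEntropyRate (fractionalGaussianNoise B) P h ∧
      h ≥ (1 + Real.log (2 * Real.pi)) / 2 + Real.log (sigma H) := by
  have hent := hasEntropy_and_entropy_noise hH0 hH1 hB
  refine ⟨fun n _ => ⟨(hent n).1, ?_⟩, ?_⟩
  · rw [(hent n).2]
    linarith [mul_log_sigmaSq_le_log_det hH0 hH1 n]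
  · obtain ⟨l, hl, ht⟩ := exists_tendsto_log_det_noiseCov hH0 hH1
    refine ⟨(1 + Real.log (2 * Real.pi)) / 2 + l / 2, ⟨fun n _ => (hent n).1, ?_⟩, ?_⟩
    · refine ((ht.div_const 2).const_add ((1 + Real.log (2 * Real.pi)) / 2)).congr' ?_
      filter_upwards [eventually_ge_atTop 1] with n hn
      have hn0 : (n : ℝ) ≠ 0 := by positivity
      rw [(hent n).2]
      field_simp
    · rw [sigma, Real.log_sqrt (sigmaSq_pos hH0 hH1).le]
      linarith
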